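/- **Theorem 6.6.** All languages are relational, with predicate symbols of arity at least $1$, and structures are nonempty unless said otherwise. A complete theory is the set of all sentences, in its own language, that are true in some nonempty structure of that language. Let $\mathcal T$ be an infinite set of complete theories (their languages may differ and may share symbols). For a set $\{T_i\mid i\in I\}\subseteq\mathcal T$ of pairwise distinct theories and models $\mathcal A_i\models T_i$ with pairwise disjoint universes, the disjoint $P$-combination $\mathcal A_P$ is the structure with universe $\bigcup_{i\in I}A_i$, in the union of the languages of the $T_i$ together with new unary predicate symbols $P_i$ $(i\in I)$, in which $P_i$ is interpreted by $A_i$ and each old symbol $R$ by the union of the relations $R^{\mathcal A_i}$ over those $i$ for which $R$ belongs to the language of $T_i$. Let $p_\infty(x)=\{\neg P_i(x)\mid i\in I\}$. For $\mathcal A'\equiv\mathcal A_P$ let $\mathcal A'_\infty$ be the restriction of $\mathcal A'$ to the set of realizations of $p_\infty(x)$, regarded as a structure in the union of the languages of the $T_i$. Let $\hat c^{\,d}_P(\mathcal T)$ be the set of all finite cardinalities of models of the theories ${\rm Th}(\mathcal A'_\infty)$, where $\{T_i\mid i\in I\}$ ranges over all subsets of $\mathcal T$, $(\mathcal A_i)_{i\in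 I}$ over all families of models of these theories with pairwise disjoint universes, and $\mathcal A'$ over all structures elementarily equivalent to $\mathcal A_P$ for which $\mathcal A'_\infty$ is nonempty. Then there is a set $K\subseteq\omega$ such that $$\hat c^{\,d}_P(\mathcal T)=\biguplus_{k\in K}k\mathbb Z^+,$$ where $k\mathbb Z^+=\{kj\mid j\in\mathbb Z,\ j\ge 1\}$ and $\biguplus_{k\in K}k\mathbb Z^+$ is the set of all sums $m_1+\dots+m_r$ with $r\ge 1$ and every $m_s$ in $\bigcup_{k\in K}k\mathbb Z^+$ (so it is empty for $K=\varnothing$). -/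

import Mathlib

open scoped FirstOrder

universe u v w

namespace PCombination

/-- The sublanguage of a relational language `L` with the set `σ n` of `n`-ary predicate symbols. -/
def subLang (L : FirstOrder.Language.{u, v}) (σ : ∀ n, Set (L.Relations n)) : FirstOrder.Language.{u, v} :=
  ⟨L.Functions, fun n => σ n⟩

instance instRelationalSubLang (L : FirstOrder.Language.{u, v}) [hL : L.IsRelational]
    (σ : ∀ n, Set (L.Relations n)) : (subLang L σ).IsRelational :=
  fun n => hL n

/-- Complete elementary theories, that is, theories of nonempty structures, in relational
languages. All predicate symbols are taken from an ambient relational language `L`; the language of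
each theory is its own subset of these symbols. Equality is equality of the languages and of the
sets of sentences. -/
structure CompleteTheory (L : FirstOrder.Language.{u, v}) where
  symbols : ∀ n, Set (L.Relations n)
  sentences : (subLang L symbols).Theory
  isMaximal : sentences.IsMaximal

/-- One unary predicate symbol `P i` for each index `i`, and nothing else. -/
inductive PSymbol (I : Type w) : ℕ → Type w
  | pred (i : I) : PSymbol I 1

/-- The language consisting of the new unary predicates `P i`. -/
def pLang (I : Type w) : FirstOrder.Language.{0, w} := ⟨fun _ => Empty, PSymbol I⟩

instance instRelationalPLang (I : Type w) : (pLang I).IsRelational :=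
  fun _ => inferInstanceAs (IsEmpty Empty)

/-- The union of the languages of the components. -/
abbrev unionLang (L : FirstOrder.Language.{u, v}) {I : Type w} (σ : I → ∀ n, Set (L.Relations n)) :
    FirstOrder.Language.{u, v} :=
  subLang L (fun n => ⋃ i, σ i n)

/-- The language of a `P`-combination: the union of the languages of the components together
with the new predicates `P i`. -/
abbrev combLang (L : FirstOrder.Language.{u, v}) {I : Type w} (σ : I → ∀ n, Set (L.Relations n)) :
    FirstOrder.Language.{u, max v w} :=
  (unionLang L σ).sum (pLang I)

/-- The universe of the disjoint `P`-combination of the structures `A i`. -/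
abbrev Comb {I : Type w} (A : I → Type*) : Type _ := Σ i, A i

section CombStructure

variable {L : FirstOrder.Language.{u, v}} [L.IsRelational] {I : Type w}
  (σ : I → ∀ n, Set (L.Relations n)) (A : I → Type*) [∀ i, (subLang L (σ i)).Structure (A i)]

/-- The union of the structures `A i`: a predicate holds exactly on the tuples that lie in one
component `A i` whose language contains the symbol, and on which it holds in `A i`. -/
instance instUnionStructure : (unionLang L σ).Structure (Comb A) where
  funMap := fun f => isEmptyElim f
  RelMap := fun {n} R x => ∃ (i : I) (hR : R.1 ∈ σ i n) (y : Fin n → A i),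
    (∀ k, x k = ⟨i, y k⟩) ∧
      FirstOrder.Language.Structure.RelMap (L := subLang L (σ i)) (n := n) ⟨R.1, hR⟩ y

end CombStructure

/-- The predicate `P i` is the universe of `A i`. -/
instance instPStructure {I : Type w} (A : I → Type*) : (pLang I).Structure (Comb A) where
  funMap := fun f => isEmptyElim f
  RelMap := fun R x => match R with
    | PSymbol.pred i => (x 0).1 = i

section PInfty

variable (L : FirstOrder.Language.{u, v}) {I : Type w} (σ : I → ∀ n, Set (L.Relations n))

/-- The predicate symbol `P i` of the language of the `P`-combination. -/
def pSym (i : I) : (combLang L σ).Relations 1 := Sum.inr (PSymbol.pred i)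

/-- The type `p_∞(x) = {¬ P i x | i ∈ I}`. -/
def pInfty : Set ((combLang L σ).Formula Unit) :=
  Set.range fun i : I =>
    ∼((pSym L σ i).formula₁ (FirstOrder.Language.Term.var ()))

/-- The restriction of a structure `B` in the language of the `P`-combination to the set of
realizations of `p_∞(x)`. -/
def restrictPInfty [L.IsRelational] (B : Type*) [(combLang L σ).Structure B] :
    (combLang L σ).Substructure B where
  carrier := {b | ∀ φ ∈ pInfty L σ, φ.Realize fun _ => b}
  fun_mem := fun f => isEmptyElim f

/-- The theory of the restriction of `B` to the set of realizations of `p_∞(x)`, in the union of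
the languages of the components (the predicates `P i` are empty on this restriction). -/
def theoryPInfty [L.IsRelational] (B : Type*) [(combLang L σ).Structure B]
    [Nonempty (restrictPInfty L σ B)] : CompleteTheory L :=
  letI : (unionLang L σ).Structure (restrictPInfty L σ B) :=
    (FirstOrder.Language.LHom.sumInl : unionLang L σ →ᴸ combLang L σ).reduct _
  { symbols := fun n => ⋃ i, σ i n
    sentences := (unionLang L σ).completeTheory (restrictPInfty L σ B)
    isMaximal := FirstOrder.Language.completeTheory.isMaximal _ _ }

end PInfty

/-- The theories of the structures `A'_∞`, where `A'` is elementarily equivalent to a disjoint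
`P`-combination of models of pairwise distinct theories from `𝒯` and `A'_∞` is the (nonempty)
restriction of `A'` to the set of realizations of `p_∞(x)`. As the theories of the components are
pairwise distinct, the components are indexed by the set `S ⊆ 𝒯` of their theories. -/
def theoriesAtInfty {L : FirstOrder.Language.{u, v}} [L.IsRelational] (𝒯 : Set (CompleteTheory L)) :
    Set (CompleteTheory L) :=
  {T' | ∃ S : Set (CompleteTheory L), S ⊆ 𝒯 ∧
    ∃ (A : S → Type (max u v)) (_ : ∀ T : S, (subLang L T.1.symbols).Structure (A T)),
      (∀ T : S, Nonempty (A T) ∧ A T ⊨ T.1.sentences) ∧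
      ∃ (B : Type (max u v)) (_ : (combLang L fun T : S => T.1.symbols).Structure B),
        (Comb A ≅[combLang L fun T : S => T.1.symbols] B) ∧
        ∃ _ : Nonempty (restrictPInfty L (fun T : S => T.1.symbols) B),
          T' = theoryPInfty L (fun T : S => T.1.symbols) B}

/-- The set of finite cardinalities of (nonempty) models of the theories of restrictions to
`p_∞(x)` with respect to disjoint `P`-combinations of models of pairwise distinct theories
from `𝒯`. -/
def cHat {L : FirstOrder.Language.{u, v}} [L.IsRelational] (𝒯 : Set (CompleteTheory L)) : Set ℕ :=
  {n | ∃ T' ∈ theoriesAtInfty 𝒯,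
    ∃ (M : Type (max u v)) (_ : (subLang L T'.symbols).Structure M),
      Nonempty M ∧ M ⊨ T'.sentences ∧ Finite M ∧ Nat.card M = n}

/-- The set `k ℤ⁺` of positive integer multiples of `k`. -/
def posMultiples (k : ℕ) : Set ℕ := {m | ∃ j : ℕ, 0 < j ∧ m = k * j}

/-- The set of all sums of nonempty finite collections of elements of the sets `k ℤ⁺`, `k ∈ K`. -/
def finiteSums (K : Set ℕ) : Set ℕ :=
  {n | ∃ s : Multiset ℕ, s ≠ 0 ∧ (∀ m ∈ s, ∃ k ∈ K, m ∈ posMultiples k) ∧ s.sum = n}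

end PCombination

/-! The set of cardinalities in question is closed under addition. Such a set already equals the set
of sums of positive multiples of its own members, so it serves as its own `K`
(`finiteSums_eq_self`).

For closure, let `N` be elementarily equivalent to a combination of the `A i`, and let `C` be its
part at infinity. The predicates `P i` are pairwise disjoint in `N` and no relation leaves them, so
`N` is the disjoint union of its `P i`-parts and `C`. Relativisation makes the `P i`-part equivalent
to `A i`, and disjoint unions respect equivalence; hence the combination absorbs `C`: it is
equivalent to its own disjoint union with `C` (`sum_equivalent_sum_atInfinity`). Absorption survives
the addition of further components (`sum_equivalent_sum_option`). Given two witnesses, over `S₁`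
with `C₁` and over `S₂` with `C₂`, the combination over `S₁ ∪ S₂` absorbs both, and the part at
infinity of the result is the disjoint union of `C₁` and `C₂`, which has the required cardinality
(`add_mem_cHat`).

Elementary equivalence is replaced by finite back-and-forth games, which behave well under disjoint
union and restriction; `exists_deciding_formulas` and `exists_rank` give the two directions of the
translation. Combinations over different sets of theories are compared in one vocabulary `Symbols
L`, where absent symbols are interpreted as empty. -/

namespace PCombination

/-! ### Finite back-and-forth games -/

section Game

variable {M N P : Type*}

/-- The second player has a winning strategy in the `n`-round back-and-forth game that starts at
the position `s` and in which every position has to satisfy `Q`. -/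
def BackForth (Q : Set (M × N) → Prop) : ℕ → Set (M × N) → Prop
  | 0, s => Q s
  | n + 1, s => Q s ∧ (∀ c, ∃ d, BackForth Q n (insert (c, d) s)) ∧
      ∀ d, ∃ c, BackForth Q n (insert (c, d) s)

theorem BackForth.position {Q : Set (M × N) → Prop} {n : ℕ} {s : Set (M × N)}
    (h : BackForth Q n s) : Q s := by
  cases n with
  | zero => exact h
  | succ n => exact h.1

theorem BackForth.mono {Q Q' : Set (M × N) → Prop} (hQ : ∀ s, Q s → Q' s) {n : ℕ}
    {s : Set (M × N)} (h : BackForth Q n s) : BackForth Q' n s := by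
  induction n generalizing s with
  | zero => exact hQ s h
  | succ n ih =>
    exact ⟨hQ s h.1, fun c => (h.2.1 c).imp fun _ => ih, fun d => (h.2.2 d).imp fun _ => ih⟩

theorem BackForth.of_succ {Q : Set (M × N) → Prop} {n : ℕ}
    {s : Set (M × N)} (h : BackForth Q (n + 1) s) : BackForth Q n s := by
  induction n generalizing s with
  | zero => exact h.1
  | succ n ih =>
    exact ⟨h.1, fun c => (h.2.1 c).imp fun _ => ih, fun d => (h.2.2 d).imp fun _ => ih⟩

theorem BackForth.of_le {Q : Set (M × N) → Prop} {m n : ℕ} (hmn : m ≤ n)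
    {s : Set (M × N)} (h : BackForth Q n s) : BackForth Q m s := by
  induction n, hmn using Nat.le_induction with
  | base => exact h
  | succ n _ ih => exact ih h.of_succ

theorem BackForth.anti {Q : Set (M × N) → Prop} (hQ : ∀ s t, s ⊆ t → Q t → Q s) {n : ℕ}
    {s t : Set (M × N)} (hst : s ⊆ t) (h : BackForth Q n t) : BackForth Q n s := by
  induction n generalizing s t with
  | zero => exact hQ s t hst h
  | succ n ih =>
    exact ⟨hQ s t hst h.1, fun c => (h.2.1 c).imp fun _ => ih (Set.insert_subset_insert hst),
      fun d => (h.2.2 d).imp fun _ => ih (Set.insert_subset_insert hst)⟩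

theorem BackForth.symm {Q : Set (M × N) → Prop} {n : ℕ} {s : Set (M × N)}
    (h : BackForth Q n s) : BackForth (fun t => Q (Prod.swap ⁻¹' t)) n (Prod.swap ⁻¹' s) := by
  have swap_insert : ∀ (c : M) (d : N) (s : Set (M × N)),
      insert (d, c) (Prod.swap ⁻¹' s) = Prod.swap ⁻¹' (insert (c, d) s) := by
    intro c d s
    ext ⟨x, y⟩
    simp [and_comm]
  induction n generalizing s with
  | zero => exact h
  | succ n ih =>
    refine ⟨h.1, fun d => (h.2.2 d).imp fun c hc => ?_, fun c => (h.2.1 c).imp fun d hd => ?_⟩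
    · rw [swap_insert]; exact ih hc
    · rw [swap_insert]; exact ih hd

/-- Composition of positions. -/
def compPos (s : Set (M × N)) (t : Set (N × P)) : Set (M × P) :=
  {p | ∃ y, (p.1, y) ∈ s ∧ (y, p.2) ∈ t}

/-- Each move is answered through the middle structure. The composite of the extended positions may
contain pairs that were never played, which is why `hanti` is needed. -/
theorem BackForth.comp {Q : Set (M × N) → Prop} {Q' : Set (N × P) → Prop}
    {Q'' : Set (M × P) → Prop} (hanti : ∀ s t, s ⊆ t → Q'' t → Q'' s)
    (hQ : ∀ s t, Q s → Q' t → Q'' (compPos s t)) {n : ℕ}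
    {s : Set (M × N)} {t : Set (N × P)} (hs : BackForth Q n s) (ht : BackForth Q' n t) :
    BackForth Q'' n (compPos s t) := by
  have insert_sub : ∀ (c : M) (d : N) (e : P) (s : Set (M × N)) (t : Set (N × P)),
      insert (c, e) (compPos s t) ⊆ compPos (insert (c, d) s) (insert (d, e) t) := by
    rintro c d e s t p (rfl | ⟨y, h1, h2⟩)
    · exact ⟨d, Or.inl rfl, Or.inl rfl⟩
    · exact ⟨y, Or.inr h1, Or.inr h2⟩
  induction n generalizing s t with
  | zero => exact hQ s t hs ht
  | succ n ih =>
    refine ⟨hQ s t hs.1 ht.1, fun c => ?_, fun e => ?_⟩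
    · obtain ⟨d, hd⟩ := hs.2.1 c
      obtain ⟨e, he⟩ := ht.2.1 d
      exact ⟨e, (ih hd he).anti hanti (insert_sub c d e s t)⟩
    · obtain ⟨d, hd⟩ := ht.2.2 e
      obtain ⟨c, hc⟩ := hs.2.2 d
      exact ⟨c, (ih hc hd).anti hanti (insert_sub c d e s t)⟩

/-- Playing the entries of `y` one per round pulls a whole tuple back from `N` to `M`. -/
theorem BackForth.extend {Q : Set (M × N) → Prop} (hQ : ∀ s t, s ⊆ t → Q t → Q s) {n : ℕ}
    {s : Set (M × N)} (h : BackForth Q n s) (y : Fin n → N) :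
    ∃ x : Fin n → M, Q (s ∪ Set.range fun i => (x i, y i)) := by
  induction n generalizing s with
  | zero => exact ⟨Fin.elim0, hQ _ s (by simp) h⟩
  | succ n ih =>
    obtain ⟨c, hc⟩ := h.2.2 (y 0)
    obtain ⟨x, hx⟩ := ih hc (fun i => y i.succ)
    refine ⟨Fin.cons c x, hQ _ _ ?_ hx⟩
    rintro p (hp | ⟨i, rfl⟩)
    · exact Or.inl (Or.inr hp)
    · induction i using Fin.cases with
      | zero => exact Or.inl (Or.inl rfl)
      | succ i => exact Or.inr ⟨i, rfl⟩

end Game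

/-! ### Partial isomorphisms and game equivalence -/

/-- A set with relations named by the symbols in `Rel`. -/
structure RelModel (Rel : ℕ → Type u) where
  carrier : Type w
  rel : ∀ {n : ℕ}, Rel n → (Fin n → carrier) → Prop

namespace RelModel

variable {Rel : ℕ → Type u}

/-- The pairs in `s` form a partial isomorphism with respect to the symbols in `F`. -/
def PartialIso (F : Set (Σ n, Rel n)) (M N : RelModel.{u, w} Rel)
    (s : Set (M.carrier × N.carrier)) : Prop :=
  (∀ p ∈ s, ∀ q ∈ s, p.1 = q.1 ↔ p.2 = q.2) ∧
    ∀ (n : ℕ) (R : Rel n), ⟨n, R⟩ ∈ F → ∀ x : Fin n → M.carrier × N.carrier, (∀ i, x i ∈ s) →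
      (M.rel R (fun i => (x i).1) ↔ N.rel R (fun i => (x i).2))

theorem PartialIso.anti {F : Set (Σ n, Rel n)} {M N : RelModel.{u, w} Rel}
    (s t : Set (M.carrier × N.carrier)) (hst : s ⊆ t) (h : PartialIso F M N t) :
    PartialIso F M N s :=
  ⟨fun p hp q hq => h.1 p (hst hp) q (hst hq), fun n R hR x hx => h.2 n R hR x fun i => hst (hx i)⟩

theorem PartialIso.mono {F F' : Set (Σ n, Rel n)} (hF : F' ⊆ F) {M N : RelModel.{u, w} Rel}
    (s : Set (M.carrier × N.carrier)) (h : PartialIso F M N s) : PartialIso F' M N s :=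
  ⟨h.1, fun n R hR => h.2 n R (hF hR)⟩

/-- The second player wins every finite back-and-forth game for finitely many symbols. -/
def Equivalent (M N : RelModel.{u, w} Rel) : Prop :=
  ∀ F : Set (Σ n, Rel n), F.Finite → ∀ n, BackForth (PartialIso F M N) n ∅

theorem Equivalent.symm {M N : RelModel.{u, w} Rel} (h : Equivalent M N) : Equivalent N M := by
  intro F hF n
  refine ((h F hF n).symm).mono ?_
  rintro s ⟨h1, h2⟩
  exact ⟨fun p hp q hq => (h1 p.swap hp q.swap hq).symm,
    fun n R hR x hx => (h2 n R hR (fun i => (x i).swap) hx).symm⟩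

theorem Equivalent.trans {M N P : RelModel.{u, w} Rel} (h : Equivalent M N)
    (h' : Equivalent N P) : Equivalent M P := by
  intro F hF n
  refine (BackForth.comp (Q'' := PartialIso F M P) PartialIso.anti ?_ (h F hF n)
    (h' F hF n)).anti PartialIso.anti (Set.empty_subset _)
  rintro s t ⟨h1, h2⟩ ⟨h1', h2'⟩
  refine ⟨?_, ?_⟩
  · rintro p ⟨y, hy, hy'⟩ q ⟨z, hz, hz'⟩
    exact (h1 _ hy _ hz).trans (h1' _ hy' _ hz')
  · intro n R hR x hx
    choose y hy hy' using hx
    exact (h2 n R hR (fun i => ((x i).1, y i)) hy).trans (h2' n R hR (fun i => (y i, (x i).2)) hy')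

theorem equivalent_of_iso {M N : RelModel.{u, w} Rel} (e : M.carrier ≃ N.carrier)
    (he : ∀ (n : ℕ) (R : Rel n) x, M.rel R x ↔ N.rel R (fun i => e (x i))) : Equivalent M N := by
  intro F _ n
  suffices H : ∀ s : Set (M.carrier × N.carrier), (∀ p ∈ s, e p.1 = p.2) →
      BackForth (PartialIso F M N) n s from H ∅ (by simp)
  have base : ∀ s : Set (M.carrier × N.carrier), (∀ p ∈ s, e p.1 = p.2) → PartialIso F M N s := by
    intro s hs
    refine ⟨fun p hp q hq => ?_, fun n R _ x hx => ?_⟩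
    · rw [← hs p hp, ← hs q hq, e.apply_eq_iff_eq]
    · rw [he]
      simp only [fun i => hs (x i) (hx i)]
  induction n with
  | zero => exact base
  | succ n ih =>
    intro s hs
    refine ⟨base s hs, fun c => ⟨e c, ih _ ?_⟩, fun d => ⟨e.symm d, ih _ ?_⟩⟩
    · rintro p (rfl | hp)
      · rfl
      · exact hs p hp
    · rintro p (rfl | hp)
      · simp
      · exact hs p hp

theorem Equivalent.refl (M : RelModel.{u, w} Rel) : Equivalent M M :=
  equivalent_of_iso (Equiv.refl _) fun _ _ _ => Iff.rfl

end RelModel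

/-! ### Games and elementary equivalence -/

section Formulas

open FirstOrder FirstOrder.Language RelModel

variable {Λ : FirstOrder.Language.{u, v}}

/-- A first-order structure as a set with relations. -/
def ofStructure (Λ : FirstOrder.Language.{u, v}) (M : Type w) [Λ.Structure M] :
    RelModel.{v, w} Λ.Relations :=
  ⟨M, fun R x => Structure.RelMap R x⟩

/-- Finitely many symbols give finitely many atomic formulas in `k` variables. Inductively, the
types over the finite set for `k + 1` variables are finite in number, and one round asks only which
of them are realized. -/
theorem exists_deciding_formulas (F : Set (Σ n, Λ.Relations n)) (hF : F.Finite) (n k : ℕ) :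
    ∃ Φ : Set (Λ.BoundedFormula Empty k), Φ.Finite ∧
      ∀ (M N : Type w) [Λ.Structure M] [Λ.Structure N] (a : Fin k → M) (b : Fin k → N),
        (∀ φ ∈ Φ, φ.Realize default a ↔ φ.Realize default b) →
        BackForth (PartialIso F (ofStructure Λ M) (ofStructure Λ N)) n
          (Set.range fun i => (a i, b i)) := by
  have atomic : ∀ k, ∃ Φ : Set (Λ.BoundedFormula Empty k), Φ.Finite ∧
      ∀ (M N : Type w) [Λ.Structure M] [Λ.Structure N] (a : Fin k → M) (b : Fin k → N),
        (∀ φ ∈ Φ, φ.Realize default a ↔ φ.Realize default b) →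
        PartialIso F (ofStructure Λ M) (ofStructure Λ N) (Set.range fun i => (a i, b i)) := by
    intro k
    let eqs : Fin k × Fin k → Λ.BoundedFormula Empty k := fun p =>
      BoundedFormula.equal (Term.var (Sum.inr p.1)) (Term.var (Sum.inr p.2))
    let rels : (Σ R : F, Fin R.1.1 → Fin k) → Λ.BoundedFormula Empty k := fun p =>
      BoundedFormula.rel p.1.1.2 fun i => Term.var (Sum.inr (p.2 i))
    have := hF.to_subtype
    refine ⟨Set.range eqs ∪ Set.range rels, (Set.finite_range _).union (Set.finite_range _), ?_⟩
    intro M N _ _ a b h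
    refine ⟨?_, ?_⟩
    · rintro _ ⟨i, rfl⟩ _ ⟨j, rfl⟩
      exact h (eqs (i, j)) (Or.inl ⟨_, rfl⟩)
    · intro n R hR x hx
      choose y hy using hx
      have := h (rels ⟨⟨⟨n, R⟩, hR⟩, y⟩) (Or.inr ⟨_, rfl⟩)
      obtain rfl : (fun i => (a (y i), b (y i))) = x := funext hy
      exact this
  induction n generalizing k with
  | zero => exact atomic k
  | succ n ih =>
    obtain ⟨Φ₀, hΦ₀, H₀⟩ := atomic k
    obtain ⟨Φ, hΦ, H⟩ := ih (k + 1)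
    have := hΦ.to_subtype
    classical
    -- Some element satisfies exactly the formulas of `Φ` that lie in `Ψ`.
    let types : Set Φ → Λ.BoundedFormula Empty k := fun Ψ =>
      BoundedFormula.ex (BoundedFormula.iInf fun φ : Φ => if φ ∈ Ψ then φ.1 else φ.1.not)
    -- Only one implication is assumed, so the same claim answers moves in either structure.
    have key : ∀ (M N : Type w) [Λ.Structure M] [Λ.Structure N] (a : Fin k → M) (b : Fin k → N)
        (c : M), (∀ Ψ, (types Ψ).Realize default a → (types Ψ).Realize default b) →
        ∃ d : N, ∀ φ ∈ Φ, φ.Realize default (Fin.snoc a c : Fin (k + 1) → M) ↔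
          φ.Realize default (Fin.snoc b d : Fin (k + 1) → N) := by
      intro M N _ _ a b c h
      let Ψ : Set Φ := {φ | φ.1.Realize default (Fin.snoc a c : Fin (k + 1) → M)}
      have hΨ : (types Ψ).Realize default a := by
        refine BoundedFormula.realize_ex.2 ⟨c, BoundedFormula.realize_iInf.2 fun φ => ?_⟩
        by_cases hφ : φ ∈ Ψ
        · rw [if_pos hφ]; exact hφ
        · rw [if_neg hφ, BoundedFormula.realize_not]; exact hφ
      obtain ⟨d, hd⟩ := BoundedFormula.realize_ex.1 (h Ψ hΨ)
      refine ⟨d, fun φ hφ => ?_⟩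
      have hd' := BoundedFormula.realize_iInf.1 hd ⟨φ, hφ⟩
      by_cases hφΨ : (⟨φ, hφ⟩ : Φ) ∈ Ψ
      · rw [if_pos hφΨ] at hd'
        exact ⟨fun _ => hd', fun _ => hφΨ⟩
      · rw [if_neg hφΨ, BoundedFormula.realize_not] at hd'
        exact ⟨fun h => absurd h hφΨ, fun h => absurd h hd'⟩
    have insert_range : ∀ (M N : Type w) (a : Fin k → M) (b : Fin k → N) (c : M) (d : N),
        insert (c, d) (Set.range fun i => (a i, b i)) = Set.range fun i =>
          ((Fin.snoc a c : Fin (k + 1) → M) i, (Fin.snoc b d : Fin (k + 1) → N) i) := by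
      intro M N a b c d
      ext p
      constructor
      · rintro (rfl | ⟨i, rfl⟩)
        · exact ⟨Fin.last k, by simp⟩
        · exact ⟨i.castSucc, by simp⟩
      · rintro ⟨i, rfl⟩
        induction i using Fin.lastCases with
        | last => left; simp
        | cast i => right; exact ⟨i, by simp⟩
    refine ⟨Φ₀ ∪ Set.range types, hΦ₀.union (Set.finite_range _), ?_⟩
    intro M N _ _ a b h
    refine ⟨H₀ M N a b fun φ hφ => h φ (Or.inl hφ), fun c => ?_, fun d => ?_⟩
    · obtain ⟨d, hd⟩ := key M N a b c fun Ψ => (h _ (Or.inr ⟨Ψ, rfl⟩)).1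
      exact ⟨d, (insert_range M N a b c d).symm ▸ H M N _ _ hd⟩
    · obtain ⟨c, hc⟩ := key N M b a d fun Ψ => (h _ (Or.inr ⟨Ψ, rfl⟩)).2
      exact ⟨c, (insert_range M N a b c d).symm ▸ H M N _ _ fun φ hφ => (hc φ hφ).symm⟩

theorem equivalent_ofStructure {M N : Type w} [Λ.Structure M] [Λ.Structure N]
    (h : M ≅[Λ] N) : Equivalent (ofStructure Λ M) (ofStructure Λ N) := by
  intro F hF n
  obtain ⟨Φ, -, H⟩ := exists_deciding_formulas.{u, v, w} F hF n 0
  refine (H M N default default fun φ _ => ?_).anti PartialIso.anti (Set.empty_subset _)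
  exact (elementarilyEquivalent_iff.1 h) φ

/-- In a relational language all terms are variables, so atomic formulas need no rounds; each
quantifier costs one. -/
theorem exists_rank [Λ.IsRelational] {k : ℕ} (φ : Λ.BoundedFormula Empty k) :
    ∃ (F : Set (Σ n, Λ.Relations n)) (n : ℕ), F.Finite ∧
      ∀ (M N : Type w) [Λ.Structure M] [Λ.Structure N] (s : Set (M × N)),
        BackForth (PartialIso F (ofStructure Λ M) (ofStructure Λ N)) n s →
        ∀ (a : Fin k → M) (b : Fin k → N), (∀ i, (a i, b i) ∈ s) →
          (φ.Realize default a ↔ φ.Realize default b) := by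
  have term_var : ∀ {k : ℕ} (t : Λ.Term (Empty ⊕ Fin k)), ∃ i, t = Term.var (Sum.inr i) := by
    intro k t
    cases t with
    | var x =>
      cases x with
      | inl e => exact e.elim
      | inr i => exact ⟨i, rfl⟩
    | func f _ => exact isEmptyElim f
  induction φ with
  | falsum => exact ⟨∅, 0, Set.finite_empty, fun _ _ _ _ _ _ _ _ _ => Iff.rfl⟩
  | equal t₁ t₂ =>
    refine ⟨∅, 0, Set.finite_empty, fun M N _ _ s hs a b hab => ?_⟩
    obtain ⟨i, rfl⟩ := term_var t₁
    obtain ⟨j, rfl⟩ := term_var t₂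
    exact hs.1 _ (hab i) _ (hab j)
  | @rel k l R ts =>
    refine ⟨{⟨l, R⟩}, 0, Set.finite_singleton _, fun M N _ _ s hs a b hab => ?_⟩
    choose i hi using fun j => term_var (ts j)
    obtain rfl : ts = fun j => Term.var (Sum.inr (i j)) := funext hi
    exact hs.2 l R rfl (fun j => (a (i j), b (i j))) fun j => hab (i j)
  | imp f₁ f₂ ih₁ ih₂ =>
    obtain ⟨F₁, n₁, hF₁, H₁⟩ := ih₁
    obtain ⟨F₂, n₂, hF₂, H₂⟩ := ih₂
    refine ⟨F₁ ∪ F₂, max n₁ n₂, hF₁.union hF₂, fun M N _ _ s hs a b hab => ?_⟩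
    rw [BoundedFormula.realize_imp, BoundedFormula.realize_imp,
      H₁ M N s ((hs.of_le (le_max_left _ _)).mono (PartialIso.mono Set.subset_union_left)) a b hab,
      H₂ M N s ((hs.of_le (le_max_right _ _)).mono (PartialIso.mono Set.subset_union_right)) a b
        hab]
  | @all k f ih =>
    obtain ⟨F, n, hF, H⟩ := ih
    refine ⟨F, n + 1, hF, fun M N _ _ s hs a b hab => ?_⟩
    have step : ∀ (c : M) (d : N), BackForth (PartialIso F (ofStructure Λ M) (ofStructure Λ N)) n
        (insert (c, d) s) → (f.Realize default (Fin.snoc a c : Fin (k + 1) → M) ↔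
          f.Realize default (Fin.snoc b d : Fin (k + 1) → N)) := by
      intro c d h
      refine H M N _ h _ _ fun i => ?_
      induction i using Fin.lastCases with
      | last => rw [Fin.snoc_last, Fin.snoc_last]; exact Or.inl rfl
      | cast i => rw [Fin.snoc_castSucc, Fin.snoc_castSucc]; exact Or.inr (hab i)
    rw [BoundedFormula.realize_all, BoundedFormula.realize_all]
    constructor
    · intro h d
      obtain ⟨c, hc⟩ := hs.2.2 d
      exact (step c d hc).1 (h c)
    · intro h c
      obtain ⟨d, hd⟩ := hs.2.1 c
      exact (step c d hd).2 (h d)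

theorem elementarilyEquivalent_of_equivalent [Λ.IsRelational] {M N : Type w} [Λ.Structure M]
    [Λ.Structure N] (h : Equivalent (ofStructure Λ M) (ofStructure Λ N)) : M ≅[Λ] N := by
  refine elementarilyEquivalent_iff.2 fun φ => ?_
  obtain ⟨F, n, hF, H⟩ := exists_rank.{u, v, w} φ
  exact H M N ∅ (h F hF n) default default fun i => i.elim0

end Formulas

end PCombination

/-! ### Disjoint unions and the part at infinity -/

namespace PCombination

namespace RelModel

variable {Rel : ℕ → Type u}

/-- The disjoint union of a family of sets with relations. -/
abbrev sum {J : Type w} (A : J → RelModel.{u, w} Rel) : RelModel.{u, w} Rel where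
  carrier := Σ j, (A j).carrier
  rel R x := ∃ j, ∃ y : Fin _ → (A j).carrier, (∀ k, x k = ⟨j, y k⟩) ∧ (A j).rel R y

/-- A separate game is played in each summand: a move in summand `i` is answered in summand `i`,
while the other summands merely forgo a round. -/
theorem sum_congr_right {J : Type w} {A A' : J → RelModel.{u, w} Rel}
    (h : ∀ j, Equivalent (A j) (A' j)) : Equivalent (sum A) (sum A') := by
  intro F hF n
  let part (s : Set ((sum A).carrier × (sum A').carrier)) (j : J) :
    Set ((A j).carrier × (A' j).carrier) := {q | (⟨j, q.1⟩, ⟨j, q.2⟩) ∈ s}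
  suffices H : ∀ s : Set ((sum A).carrier × (sum A').carrier), (∀ p ∈ s, p.1.1 = p.2.1) →
      (∀ j, BackForth (PartialIso F (A j) (A' j)) n (part s j)) →
      BackForth (PartialIso F (sum A) (sum A')) n s from
    H ∅ (by simp) fun j => (h j F hF n).anti PartialIso.anti fun q hq => hq.elim
  have insert_part : ∀ (s : Set ((sum A).carrier × (sum A').carrier)) (i : J) c d n,
      (∀ j, BackForth (PartialIso F (A j) (A' j)) (n + 1) (part s j)) →
      BackForth (PartialIso F (A i) (A' i)) n (insert (c, d) (part s i)) →
      ∀ j, BackForth (PartialIso F (A j) (A' j)) n (part (insert (⟨i, c⟩, ⟨i, d⟩) s) j) := by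
    intro s i c d n hs hi j
    by_cases hij : i = j
    · subst hij
      refine hi.anti PartialIso.anti ?_
      rintro ⟨x, y⟩ (hq | hq)
      · left
        simpa using hq
      · exact Or.inr hq
    · refine (hs j).of_succ.anti PartialIso.anti ?_
      rintro ⟨x, y⟩ (hq | hq)
      · exact absurd (congrArg (fun p => p.1.1) hq).symm hij
      · exact hq
  have base : ∀ s : Set ((sum A).carrier × (sum A').carrier), (∀ p ∈ s, p.1.1 = p.2.1) →
      (∀ j, PartialIso F (A j) (A' j) (part s j)) → PartialIso F (sum A) (sum A') s := by
    intro s hs hp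
    refine ⟨?_, ?_⟩
    · rintro ⟨⟨i, a⟩, ⟨i', b⟩⟩ h1 ⟨⟨j, c⟩, ⟨j', d⟩⟩ h2
      obtain rfl : i = i' := hs _ h1
      obtain rfl : j = j' := hs _ h2
      by_cases hij : i = j
      · subst hij
        have := (hp i).1 (a, b) h1 (c, d) h2
        simpa using this
      · exact ⟨fun e => absurd (congrArg Sigma.fst e) hij,
          fun e => absurd (congrArg Sigma.fst e) hij⟩
    · intro n R hR x hx
      constructor
      · rintro ⟨j, y, hy, hRy⟩
        replace hy : ∀ k, (x k).1 = ⟨j, y k⟩ := hy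
        have hz : ∀ k, ∃ z, (x k).2 = ⟨j, z⟩ := by
          intro k
          have h1 := hs _ (hx k)
          rw [hy k] at h1
          generalize (x k).2 = t at h1
          obtain ⟨j', z⟩ := t
          obtain rfl : j = j' := h1
          exact ⟨z, rfl⟩
        choose z hz using hz
        refine ⟨j, z, hz, ((hp j).2 n R hR (fun k => (y k, z k)) fun k => ?_).1 hRy⟩
        have hxk := hx k
        rwa [show x k = (⟨j, y k⟩, ⟨j, z k⟩) from Prod.ext (hy k) (hz k)] at hxk
      · rintro ⟨j, z, hz, hRz⟩
        replace hz : ∀ k, (x k).2 = ⟨j, z k⟩ := hz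
        have hy : ∀ k, ∃ y, (x k).1 = ⟨j, y⟩ := by
          intro k
          have h1 := hs _ (hx k)
          rw [hz k] at h1
          generalize (x k).1 = t at h1
          obtain ⟨j', y⟩ := t
          obtain rfl : j' = j := h1
          exact ⟨y, rfl⟩
        choose y hy using hy
        refine ⟨j, y, hy, ((hp j).2 n R hR (fun k => (y k, z k)) fun k => ?_).2 hRz⟩
        have hxk := hx k
        rwa [show x k = (⟨j, y k⟩, ⟨j, z k⟩) from Prod.ext (hy k) (hz k)] at hxk
  induction n with
  | zero => exact base
  | succ n ih =>
    intro s hs hp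
    have insert_fst : ∀ (i : J) (c : (A i).carrier) (d : (A' i).carrier),
        ∀ p ∈ (insert (⟨i, c⟩, ⟨i, d⟩) s : Set ((sum A).carrier × (sum A').carrier)),
          p.1.1 = p.2.1 := by
      rintro i c d p (rfl | hp)
      · rfl
      · exact hs p hp
    refine ⟨base s hs fun j => (hp j).1, ?_, ?_⟩
    · rintro ⟨i, c⟩
      obtain ⟨d, hd⟩ := (hp i).2.1 c
      exact ⟨⟨i, d⟩, ih _ (insert_fst i c d) (insert_part s i c d n hp hd)⟩
    · rintro ⟨i, d⟩
      obtain ⟨c, hc⟩ := (hp i).2.2 d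
      exact ⟨⟨i, c⟩, ih _ (insert_fst i c d) (insert_part s i c d n hp hc)⟩

theorem sum_equivalent_of_equiv {J : Type w} {A : J → RelModel.{u, w} Rel} {M : RelModel.{u, w} Rel}
    (e : (Σ j, (A j).carrier) ≃ M.carrier)
    (he : ∀ (n : ℕ) (R : Rel n) (x : Fin n → M.carrier), M.rel R x ↔
      ∃ j, ∃ y : Fin n → (A j).carrier, (∀ k, x k = e ⟨j, y k⟩) ∧ (A j).rel R y) :
    Equivalent (sum A) M := by
  refine equivalent_of_iso e fun n R x => ?_
  rw [he]
  simp only [sum, e.apply_eq_iff_eq]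

theorem sum_reindex {J J' : Type w} (e : J ≃ J') (A : J' → RelModel.{u, w} Rel) :
    Equivalent (sum fun j => A (e j)) (sum A) := by
  refine sum_equivalent_of_equiv (Equiv.sigmaCongrLeft (β := fun j => (A j).carrier) e)
    fun n R x => ?_
  constructor
  · rintro ⟨j, y, hy, hR⟩
    obtain ⟨i, rfl⟩ := e.surjective j
    exact ⟨i, y, hy, hR⟩
  · rintro ⟨i, y, hy, hR⟩
    exact ⟨e i, y, hy, hR⟩

theorem sum_congr {J J' : Type w} {A : J → RelModel.{u, w} Rel} {A' : J' → RelModel.{u, w} Rel}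
    (e : J ≃ J') (h : ∀ j, Equivalent (A j) (A' (e j))) : Equivalent (sum A) (sum A') :=
  (sum_congr_right h).trans (sum_reindex e A')

theorem sum_fiber {J K : Type w} (q : J → K) (A : J → RelModel.{u, w} Rel) :
    Equivalent (sum fun k => sum fun j : {j // q j = k} => A j) (sum A) := by
  refine sum_equivalent_of_equiv
    { toFun := fun p => ⟨p.2.1.1, p.2.2⟩
      invFun := fun p => ⟨q p.1, ⟨p.1, rfl⟩, p.2⟩
      left_inv := by rintro ⟨k, ⟨j, rfl⟩, x⟩; rfl
      right_inv := fun p => rfl } fun n R x => ?_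
  constructor
  · rintro ⟨j, y, hy, hR⟩
    exact ⟨q j, fun k => ⟨⟨j, rfl⟩, y k⟩, hy, ⟨j, rfl⟩, y, fun _ => rfl, hR⟩
  · rintro ⟨k, y, hy, j, z, hz, hR⟩
    refine ⟨j.1, z, fun i => ?_, hR⟩
    rw [hy i]
    simp only [hz i]
    rfl

/-- A subfamily may be replaced as a block, even if its members do not match one by one. Both sums
are grouped into the block and the rest. -/
theorem sum_congr_of_range {I I' J J' : Type w} {A : J → RelModel.{u, w} Rel}
    {A' : J' → RelModel.{u, w} Rel} {i : I → J} (hi : i.Injective) {i' : I' → J'}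
    (hi' : i'.Injective) (h : Equivalent (sum fun k : I => A (i k)) (sum fun k : I' => A' (i' k)))
    (e : {j // j ∉ Set.range i} ≃ {j // j ∉ Set.range i'}) (he : ∀ j, Equivalent (A j.1) (A' (e j).1)) :
    Equivalent (sum A) (sum A') := by
  -- The two blocks are the fibres of the truth value of membership in the range, lifted to the
  -- universe of the index types.
  refine (sum_fiber (fun j => ULift.up.{w} (j ∈ Set.range i)) A).symm.trans
    (Equivalent.trans (sum_congr_right fun k => ?_)
    (sum_fiber (fun j => ULift.up.{w} (j ∈ Set.range i')) A'))
  obtain ⟨k⟩ := k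
  by_cases hk : k
  · obtain rfl : k = True := eq_true hk
    have range_part : ∀ {I J : Type w} (A : J → RelModel.{u, w} Rel) {i : I → J}, i.Injective →
        Equivalent (sum fun k => A (i k))
          (sum fun j : {j // ULift.up.{w} (j ∈ Set.range i) = ⟨True⟩} => A j) := by
      intro I J A i hi
      refine sum_congr (Equiv.ofBijective (fun k => ⟨i k, by simp⟩) ⟨?_, ?_⟩)
        fun k => Equivalent.refl _
      · intro k l hkl
        exact hi (congrArg Subtype.val hkl)
      · rintro ⟨j, hj⟩
        obtain ⟨k, rfl⟩ : j ∈ Set.range i := of_eq_true (congrArg ULift.down hj)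
        exact ⟨k, rfl⟩
    exact ((range_part A hi).symm.trans h).trans (range_part A' hi')
  · obtain rfl : k = False := eq_false hk
    have up_iff : ∀ p : Prop, ULift.up.{w} p = ⟨False⟩ ↔ ¬ p := by simp
    exact sum_congr (((Equiv.subtypeEquivRight fun j => up_iff _).trans e).trans
      (Equiv.subtypeEquivRight fun j => up_iff _).symm) fun j => he ⟨j, (up_iff _).1 j.2⟩

theorem sum_equivalent_sum_option {I J : Type w} {A : J → RelModel.{u, w} Rel}
    {A' : I → RelModel.{u, w} Rel} {C : RelModel.{u, w} Rel} {i : I → J} (hi : i.Injective)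
    (hA : ∀ k, Equivalent (A (i k)) (A' k))
    (h : Equivalent (sum A') (sum fun o : Option I => o.elim C A')) :
    Equivalent (sum A) (sum fun o : Option J => o.elim C A) := by
  refine sum_congr_of_range hi (Option.map_injective hi) (((sum_congr_right hA).trans h).trans
    (sum_congr_right fun o => ?_)) (Equiv.ofBijective (fun j => ⟨some j.1, ?_⟩) ⟨?_, ?_⟩)
    fun j => Equivalent.refl _
  · cases o with
    | none => exact Equivalent.refl _
    | some k => exact (hA k).symm
  · rintro ⟨_ | k, hk⟩
    · cases hk
    · exact j.2 ⟨k, Option.some_injective _ hk⟩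
  · intro j k hjk
    exact Subtype.ext (Option.some_injective _ (congrArg Subtype.val hjk))
  · rintro ⟨_ | j, hj⟩
    · exact absurd ⟨none, rfl⟩ hj
    · refine ⟨⟨j, ?_⟩, rfl⟩
      rintro ⟨k, rfl⟩
      exact hj ⟨some k, rfl⟩

/-- The restriction to a subset. -/
abbrev restrict (M : RelModel.{u, w} Rel) (p : M.carrier → Prop) : RelModel.{u, w} Rel where
  carrier := {x // p x}
  rel R x := M.rel R fun k => (x k).1

/-- With `P` among the symbols of the game, answers to moves inside `P` stay inside `P`, so the same
strategy works on the restrictions. -/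
theorem Equivalent.restrict_pred {M N : RelModel.{u, w} Rel} (h : Equivalent M N) (P : Rel 1) :
    Equivalent (M.restrict fun b => M.rel P fun _ => b) (N.restrict fun b => N.rel P fun _ => b) := by
  intro F hF n
  suffices H : ∀ s : Set (M.carrier × N.carrier),
      BackForth (PartialIso (insert ⟨1, P⟩ F) M N) n s →
      BackForth (PartialIso F (M.restrict fun b => M.rel P fun _ => b)
        (N.restrict fun b => N.rel P fun _ => b)) n {q | (q.1.1, q.2.1) ∈ s} from
    (H ∅ (h _ (hF.insert _) n)).anti PartialIso.anti (Set.empty_subset _)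
  have pred_iff : ∀ (s : Set (M.carrier × N.carrier)) n c d,
      BackForth (PartialIso (insert ⟨1, P⟩ F) M N) n (insert (c, d) s) →
      ((M.rel P fun _ => c) ↔ N.rel P fun _ => d) := fun s n c d hs =>
    hs.position.2 1 P (Set.mem_insert _ _) (fun _ => (c, d)) fun _ => Set.mem_insert _ _
  have base : ∀ s : Set (M.carrier × N.carrier), PartialIso (insert ⟨1, P⟩ F) M N s →
      PartialIso F (M.restrict fun b => M.rel P fun _ => b)
        (N.restrict fun b => N.rel P fun _ => b) {q | (q.1.1, q.2.1) ∈ s} := by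
    intro s hs
    refine ⟨fun p hp q hq => ?_, fun n R hR x hx => ?_⟩
    · exact Subtype.ext_iff.trans ((hs.1 _ hp _ hq).trans Subtype.ext_iff.symm)
    · exact hs.2 n R (Set.mem_insert_of_mem _ hR) (fun k => ((x k).1.1, (x k).2.1)) hx
  have insert_sub : ∀ (s : Set (M.carrier × N.carrier)) c d hc hd,
      insert (⟨c, hc⟩, ⟨d, hd⟩) {q : (M.restrict fun b => M.rel P fun _ => b).carrier ×
        (N.restrict fun b => N.rel P fun _ => b).carrier | (q.1.1, q.2.1) ∈ s} ⊆
        {q | (q.1.1, q.2.1) ∈ insert (c, d) s} := by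
    rintro s c d hc hd q (rfl | hq)
    · exact Or.inl rfl
    · exact Or.inr hq
  induction n with
  | zero => exact base
  | succ n ih =>
    intro s hs
    refine ⟨base s hs.1, ?_, ?_⟩
    · rintro ⟨c, hc⟩
      obtain ⟨d, hd⟩ := hs.2.1 c
      exact ⟨⟨d, (pred_iff s n c d hd).1 hc⟩, (ih _ hd).anti PartialIso.anti (insert_sub ..)⟩
    · rintro ⟨d, hd⟩
      obtain ⟨c, hc⟩ := hs.2.2 d
      exact ⟨⟨c, (pred_iff s n c d hc).2 hd⟩, (ih _ hc).anti PartialIso.anti (insert_sub ..)⟩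

/-- The set of elements outside of all the unary predicates `P j`. -/
def atInfinity {J : Type w} (N : RelModel.{u, w} Rel) (P : J → Rel 1) : RelModel.{u, w} Rel :=
  N.restrict fun b => ∀ j, ¬ N.rel (P j) fun _ => b

/-- Disjointness of the predicates and the absence of relations across them involve finitely many
symbols and elements at a time, so a short game carries them from the sum to `N`. Positive arity
ensures that each related tuple determines its part. -/
theorem sum_equivalent_sum_atInfinity [IsEmpty (Rel 0)] {J : Type w} {A : J → RelModel.{u, w} Rel}
    {P : J → Rel 1} (hP : ∀ i j y, (A i).rel (P j) y ↔ j = i) {N : RelModel.{u, w} Rel}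
    (h : Equivalent (sum A) N) :
    Equivalent (sum A) (sum fun o : Option J => o.elim (N.atInfinity P) A) := by
  have sum_pred : ∀ j x, (sum A).rel (P j) x ↔ (x 0).1 = j := by
    intro j x
    constructor
    · rintro ⟨i, y, hy, hR⟩
      rw [hy, (hP i j y).1 hR]
    · rintro rfl
      refine ⟨(x 0).1, fun _ => (x 0).2, fun k => ?_, (hP _ _ _).2 rfl⟩
      obtain rfl : k = 0 := Subsingleton.elim k 0
      rfl
  have disjoint : ∀ i j b, (N.rel (P i) fun _ => b) → (N.rel (P j) fun _ => b) → i = j := by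
    intro i j b hi hj
    obtain ⟨c, hc⟩ := (h {⟨1, P i⟩, ⟨1, P j⟩} (Set.toFinite _) 1).2.2 b
    have hci := (hc.position.2 1 (P i) (by simp) (fun _ => (c, b)) (by simp)).2 hi
    have hcj := (hc.position.2 1 (P j) (by simp) (fun _ => (c, b)) (by simp)).2 hj
    rw [sum_pred] at hci hcj
    exact hci.symm.trans hcj
  have local_rel : ∀ (n : ℕ) (R : Rel n) x, N.rel R x → ∀ j k l, (N.rel (P j) fun _ => x k) →
      N.rel (P j) fun _ => x l := by
    intro n R x hx j k l hk
    obtain ⟨c, hc⟩ := (h {⟨n, R⟩, ⟨1, P j⟩} (Set.toFinite _) n).extend PartialIso.anti x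
    have hmem : ∀ i, (c i, x i) ∈
        ((∅ ∪ Set.range fun i => (c i, x i)) : Set ((sum A).carrier × N.carrier)) :=
      fun i => Or.inr ⟨i, rfl⟩
    have hcR := (hc.2 n R (by simp) (fun i => (c i, x i)) hmem).2 hx
    have hck := (hc.2 1 (P j) (by simp) (fun _ => (c k, x k)) fun _ => hmem k).2 hk
    refine (hc.2 1 (P j) (by simp) (fun _ => (c l, x l)) fun _ => hmem l).1 ?_
    obtain ⟨i, y, hy, -⟩ := hcR
    rw [sum_pred] at hck ⊢
    replace hy : ∀ k, c k = ⟨i, y k⟩ := hy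
    have hkl : (c k).1 = (c l).1 := by rw [hy k, hy l]
    exact hkl.symm.trans hck
  have component : ∀ j, Equivalent (A j) (N.restrict fun b => N.rel (P j) fun _ => b) := by
    intro j
    refine Equivalent.trans (equivalent_of_iso (Equiv.ofBijective
      (fun a => (⟨⟨j, a⟩, (sum_pred j _).2 rfl⟩ :
        ((sum A).restrict fun b => (sum A).rel (P j) fun _ => b).carrier)) ⟨?_, ?_⟩)
      fun n R x => ?_) (h.restrict_pred (P j))
    · intro a b hab
      exact eq_of_heq (Sigma.mk.inj (congrArg Subtype.val hab)).2
    · rintro ⟨⟨i, a⟩, ha⟩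
      obtain rfl : i = j := (sum_pred j _).1 ha
      exact ⟨a, rfl⟩
    · constructor
      · intro hx
        exact ⟨j, x, fun _ => rfl, hx⟩
      · rintro ⟨i, y, hy, hR⟩
        cases n with
        | zero => exact isEmptyElim R
        | succ n =>
          obtain rfl : j = i := congrArg Sigma.fst (hy 0)
          obtain rfl : x = y := funext fun k => eq_of_heq (Sigma.mk.inj (hy k)).2
          exact hR
  -- The index `none` stands for the part at infinity, `some j` for the part named by `P j`.
  let D : Option J → RelModel.{u, w} Rel := fun o =>
    o.elim (N.atInfinity P) fun j => N.restrict fun b => N.rel (P j) fun _ => b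
  let p : Option J → N.carrier → Prop := fun o b =>
    o.elim (∀ j, ¬ N.rel (P j) fun _ => b) fun j => N.rel (P j) fun _ => b
  have hD : ∀ o, D o = N.restrict (p o) := by rintro (_ | j) <;> rfl
  have p_exists : ∀ b, ∃ o, p o b := by
    intro b
    by_cases hb : ∃ j, N.rel (P j) fun _ => b
    · exact hb.elim fun j hj => ⟨some j, hj⟩
    · exact ⟨none, not_exists.1 hb⟩
  have p_unique : ∀ b o o', p o b → p o' b → o = o' := by
    rintro b (_ | i) (_ | j) h1 h2
    · rfl
    · exact absurd h2 (h1 j)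
    · exact absurd h1 (h2 i)
    · exact congrArg some (disjoint i j b h1 h2)
  have p_local : ∀ (n : ℕ) (R : Rel n) x, N.rel R x → ∀ o k l, p o (x k) → p o (x l) := by
    rintro n R x hx (_ | j) k l hk
    · exact fun j hj => hk j (local_rel n R x hx j l k hj)
    · exact local_rel n R x hx j k l hk
  have decomposition : Equivalent (sum D) N := by
    rw [funext hD]
    refine sum_equivalent_of_equiv (Equiv.ofBijective (fun q => q.2.1) ⟨?_, ?_⟩) fun n R x => ?_
    · rintro ⟨o, a, ha⟩ ⟨o', b, hb⟩ hab
      obtain rfl : a = b := hab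
      obtain rfl : o = o' := p_unique a o o' ha hb
      rfl
    · intro b
      obtain ⟨o, ho⟩ := p_exists b
      exact ⟨⟨o, b, ho⟩, rfl⟩
    · constructor
      · intro hx
        cases n with
        | zero => exact isEmptyElim R
        | succ n =>
          obtain ⟨o, ho⟩ := p_exists (x 0)
          exact ⟨o, fun k => ⟨x k, p_local _ R x hx o 0 k ho⟩, fun _ => rfl, hx⟩
      · rintro ⟨o, y, hy, hR⟩
        rw [show x = fun k => (y k).1 from funext hy]
        exact hR
  refine (h.trans decomposition.symm).trans (sum_congr_right ?_)
  rintro (_ | j)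
  · exact Equivalent.refl _
  · exact (component j).symm

end RelModel

end PCombination

/-! ### Change of vocabulary and finite cardinalities -/

namespace PCombination

open FirstOrder FirstOrder.Language RelModel

/-- A new symbol either copies an old one or has the same constant truth value on both sides, as a
symbol absent from the language does; the latter places no demand on the game. -/
theorem RelModel.Equivalent.transfer {Rel : ℕ → Type u} {Rel' : ℕ → Type v}
    {M N : RelModel.{u, w} Rel} (h : Equivalent M N) {M' N' : RelModel.{v, w} Rel'}
    (f : M'.carrier ≃ M.carrier) (g : N'.carrier ≃ N.carrier)
    (H : ∀ (n : ℕ) (R' : Rel' n),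
      (∃ R : Rel n, (∀ x, M'.rel R' x ↔ M.rel R fun i => f (x i)) ∧
        ∀ x, N'.rel R' x ↔ N.rel R fun i => g (x i)) ∨
      ∃ p : Prop, (∀ x, M'.rel R' x ↔ p) ∧ ∀ x, N'.rel R' x ↔ p) :
    Equivalent M' N' := by
  let M₁ : RelModel.{v, w} Rel' := ⟨M.carrier, fun R x => M'.rel R fun i => f.symm (x i)⟩
  let N₁ : RelModel.{v, w} Rel' := ⟨N.carrier, fun R x => N'.rel R fun i => g.symm (x i)⟩
  have hM : Equivalent M' M₁ := equivalent_of_iso f fun n R x => by simp [M₁]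
  have hN : Equivalent N' N₁ := equivalent_of_iso g fun n R x => by simp [N₁]
  refine (hM.trans ?_).trans hN.symm
  intro F hF n
  have support : ∀ R' : Σ n, Rel' n, ∃ G : Set (Σ n, Rel n), G.Finite ∧
      ∀ s : Set (M.carrier × N.carrier), PartialIso G M N s →
        ∀ x : Fin R'.1 → M.carrier × N.carrier, (∀ i, x i ∈ s) →
          (M₁.rel R'.2 (fun i => (x i).1) ↔ N₁.rel R'.2 (fun i => (x i).2)) := by
    rintro ⟨n, R'⟩
    obtain ⟨R, hR, hR'⟩ | ⟨p, hp, hp'⟩ := H n R'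
    · refine ⟨{⟨n, R⟩}, Set.finite_singleton _, fun s hs x hx => ?_⟩
      simp only [M₁, N₁, hR, hR', Equiv.apply_symm_apply]
      exact hs.2 n R rfl x hx
    · exact ⟨∅, Set.finite_empty, fun s hs x hx => (hp _).trans (hp' _).symm⟩
  choose G hG hGs using support
  refine (h (⋃ R' ∈ F, G R') (hF.biUnion fun R' _ => hG R') n).mono fun s hs =>
    ⟨hs.1, fun n R' hR' x hx => hGs ⟨n, R'⟩ s (hs.mono ?_ s) x hx⟩
  exact Set.subset_biUnion_of_mem (u := G) hR'

theorem finite_and_card_eq {Λ : FirstOrder.Language.{u, v}} {M N : Type w} [Λ.Structure M]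
    [Λ.Structure N] (h : M ≅[Λ] N) [Finite M] : Finite N ∧ Nat.card N = Nat.card M := by
  have key : ∀ n : ℕ, (n : Cardinal) ≤ Cardinal.mk M ↔ (n : Cardinal) ≤ Cardinal.mk N := by
    intro n
    rw [← Sentence.realize_cardGe Λ n, ← Sentence.realize_cardGe Λ n]
    exact elementarilyEquivalent_iff.1 h _
  rw [← Nat.cast_card (α := M)] at key
  have hlt : Cardinal.mk N < ((Nat.card M + 1 : ℕ) : Cardinal) := by
    rw [← not_le, ← key, Nat.cast_le]
    omega
  have hN : Finite N := Cardinal.mk_lt_aleph0_iff.1 (hlt.trans (Cardinal.natCast_lt_aleph0))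
  rw [← Nat.cast_card (α := N)] at key hlt
  refine ⟨hN, le_antisymm (Nat.lt_succ_iff.1 (Nat.cast_lt.1 hlt)) ?_⟩
  exact Nat.cast_le.1 ((key _).1 le_rfl)

/-! ### Combinations in a common vocabulary -/

section Components

variable {L : FirstOrder.Language.{u, v}}

/-- The symbols of `L` together with a unary predicate for each complete theory. -/
abbrev Symbols (L : FirstOrder.Language.{u, v}) (n : ℕ) : Type (max u v) :=
  L.Relations n ⊕ PSymbol (CompleteTheory L) n

/-- The unary predicate that names the component with the theory `T`. -/
abbrev predSymbol (T : CompleteTheory L) : Symbols L 1 := Sum.inr (PSymbol.pred T)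

instance [IsEmpty (L.Relations 0)] : IsEmpty (Symbols L 0) :=
  ⟨fun R => match R with | Sum.inl R => isEmptyElim R⟩

/-- A model of `T` as the component named by `T`. -/
def component (T : CompleteTheory L) (A : Type (max u v)) [(subLang L T.symbols).Structure A] :
    RelModel.{max u v, max u v} (Symbols L) where
  carrier := A
  rel {n} R y := match R with
    | Sum.inl R => ∃ hR : R ∈ T.symbols n,
        Structure.RelMap (L := subLang L T.symbols) (n := n) ⟨R, hR⟩ y
    | Sum.inr (PSymbol.pred T') => T' = T

/-- Being the component named by `T` given by a nonempty model of `T`. -/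
def IsComponent (T : CompleteTheory L) (D : RelModel.{max u v, max u v} (Symbols L)) : Prop :=
  ∃ (A : Type (max u v)) (_ : (subLang L T.symbols).Structure A),
    (Nonempty A ∧ A ⊨ T.sentences) ∧ D = component T A

theorem IsComponent.rel_predSymbol {T : CompleteTheory L}
    {D : RelModel.{max u v, max u v} (Symbols L)} (h : IsComponent T D) (T' : CompleteTheory L)
    (y : Fin 1 → D.carrier) : D.rel (predSymbol T') y ↔ T' = T := by
  obtain ⟨A, _, -, rfl⟩ := h
  exact Iff.rfl

/-- Completeness of `T` settles its own symbols; all others are constant on both components. Thus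
the choice of the model of `T` is immaterial. -/
theorem IsComponent.equivalent {T : CompleteTheory L}
    {D D' : RelModel.{max u v, max u v} (Symbols L)} (h : IsComponent T D)
    (h' : IsComponent T D') : Equivalent D D' := by
  obtain ⟨A, _, ⟨hA, hAT⟩, rfl⟩ := h
  obtain ⟨A', _, ⟨hA', hAT'⟩, rfl⟩ := h'
  have hAA' : A ≅[subLang L T.symbols] A' := elementarilyEquivalent_iff.2 fun φ =>
    (T.isMaximal.isComplete.realize_sentence_iff φ A).trans
      (T.isMaximal.isComplete.realize_sentence_iff φ A').symm
  refine (equivalent_ofStructure hAA').transfer (Equiv.refl _) (Equiv.refl _) fun n R => ?_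
  cases R with
  | inl R =>
    by_cases hR : R ∈ T.symbols n
    · exact Or.inl ⟨⟨R, hR⟩, fun x => ⟨fun h => h.2, fun h => ⟨hR, h⟩⟩,
        fun x => ⟨fun h => h.2, fun h => ⟨hR, h⟩⟩⟩
    · exact Or.inr ⟨False, fun x => ⟨fun h => hR h.1, False.elim⟩,
        fun x => ⟨fun h => hR h.1, False.elim⟩⟩
  | inr P =>
    cases P with
    | pred T' => exact Or.inr ⟨T' = T, fun x => Iff.rfl, fun x => Iff.rfl⟩

variable (S : Set (CompleteTheory L))

/-- The language of the `P`-combinations of models of the theories in `S`. -/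
abbrev combLangOf : FirstOrder.Language.{u, max u v} := combLang L fun T : S => T.1.symbols

/-- A structure in the language of a `P`-combination, with the absent symbols empty. -/
def ofCombStructure (B : Type (max u v)) [(combLangOf S).Structure B] :
    RelModel.{max u v, max u v} (Symbols L) where
  carrier := B
  rel {n} R y := match R with
    | Sum.inl R => ∃ hR : R ∈ ⋃ T : S, T.1.symbols n,
        Structure.RelMap (L := combLangOf S) (n := n) (Sum.inl ⟨R, hR⟩) y
    | Sum.inr (PSymbol.pred T) => ∃ hT : T ∈ S,
        Structure.RelMap (L := combLangOf S) (n := 1) (Sum.inr (PSymbol.pred ⟨T, hT⟩)) y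

/-- The symbol of `Symbols L` that corresponds to a predicate symbol of the language of a
`P`-combination. -/
def toSymbol {n : ℕ} : (combLangOf S).Relations n → Symbols L n
  | Sum.inl R => Sum.inl R.1
  | Sum.inr (PSymbol.pred T) => predSymbol T.1

/-- The structure in the language of a `P`-combination given by a set with relations. -/
@[reducible]
def combStructure [L.IsRelational] (N : RelModel.{max u v, max u v} (Symbols L)) :
    (combLangOf S).Structure N.carrier where
  funMap := fun f => isEmptyElim f
  RelMap := fun R x => N.rel (toSymbol S R) x

variable {S}

theorem ofCombStructure_equivalent {B B' : Type (max u v)} [(combLangOf S).Structure B]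
    [(combLangOf S).Structure B'] (h : B ≅[combLangOf S] B') :
    Equivalent (ofCombStructure S B) (ofCombStructure S B') := by
  refine (equivalent_ofStructure h).transfer (Equiv.refl _) (Equiv.refl _) fun n R => ?_
  cases R with
  | inl R =>
    by_cases hR : R ∈ ⋃ T : S, T.1.symbols n
    · exact Or.inl ⟨Sum.inl ⟨R, hR⟩, fun x => ⟨fun h => h.2, fun h => ⟨hR, h⟩⟩,
        fun x => ⟨fun h => h.2, fun h => ⟨hR, h⟩⟩⟩
    · exact Or.inr ⟨False, fun x => ⟨fun h => hR h.1, False.elim⟩,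
        fun x => ⟨fun h => hR h.1, False.elim⟩⟩
  | inr P =>
    cases P with
    | pred T =>
      by_cases hT : T ∈ S
      · exact Or.inl ⟨Sum.inr (PSymbol.pred ⟨T, hT⟩), fun x => ⟨fun h => h.2, fun h => ⟨hT, h⟩⟩,
          fun x => ⟨fun h => h.2, fun h => ⟨hT, h⟩⟩⟩
      · exact Or.inr ⟨False, fun x => ⟨fun h => hT h.1, False.elim⟩,
          fun x => ⟨fun h => hT h.1, False.elim⟩⟩

/-- A predicate naming a theory outside `S` is empty in the sum, and a one-round game shows that it
is empty in `N`. -/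
theorem mem_of_rel_predSymbol
    {D : S → RelModel.{max u v, max u v} (Symbols L)} (hD : ∀ T : S, IsComponent T.1 (D T))
    {N : RelModel.{max u v, max u v} (Symbols L)} (h : Equivalent (RelModel.sum D) N)
    {T : CompleteTheory L} {b : N.carrier} (hb : N.rel (predSymbol T) fun _ => b) : T ∈ S := by
  obtain ⟨c, hc⟩ := (h {⟨1, predSymbol T⟩} (Set.finite_singleton _) 1).2.2 b
  obtain ⟨T', y, -, hT⟩ := (hc.position.2 1 (predSymbol T) rfl (fun _ => (c, b)) (by simp)).2 hb
  rw [((hD T').rel_predSymbol T y).1 hT]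
  exact T'.2

variable [L.IsRelational]

theorem relMap_comb_iff (A : S → Type (max u v)) [∀ T : S, (subLang L T.1.symbols).Structure (A T)]
    {n : ℕ} (R : (combLangOf S).Relations n) (x : Fin n → Comb A) :
    Structure.RelMap R x ↔ (RelModel.sum fun T : S => component T.1 (A T)).rel (toSymbol S R) x := by
  cases R with
  | inl R =>
    constructor
    · rintro ⟨T, hR, y, hy, h⟩
      exact ⟨T, y, hy, hR, h⟩
    · rintro ⟨T, y, hy, hR, h⟩
      exact ⟨T, hR, y, hy, h⟩
  | inr P =>
    cases P with
    | pred T =>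
      constructor
      · intro (h : (x 0).1 = T)
        subst h
        refine ⟨(x 0).1, fun _ => (x 0).2, fun k => ?_, rfl⟩
        obtain rfl : k = 0 := Subsingleton.elim k 0
        rfl
      · rintro ⟨T', y, hy, h⟩
        obtain rfl : T = T' := Subtype.ext h
        exact congrArg Sigma.fst (hy 0)

theorem sum_component_equivalent (A : S → Type (max u v))
    [∀ T : S, (subLang L T.1.symbols).Structure (A T)] :
    Equivalent (RelModel.sum fun T : S => component T.1 (A T)) (ofCombStructure S (Comb A)) := by
  refine equivalent_of_iso (Equiv.refl _) fun n R x => ?_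
  cases R with
  | inl R =>
    constructor
    · rintro ⟨T, y, hy, hR, h⟩
      exact ⟨Set.mem_iUnion_of_mem T hR, (relMap_comb_iff A _ x).2 ⟨T, y, hy, hR, h⟩⟩
    · rintro ⟨hR, h⟩
      exact (relMap_comb_iff A _ x).1 h
  | inr P =>
    cases P with
    | pred T =>
      constructor
      · rintro ⟨T', y, hy, h⟩
        obtain rfl : T = T' := h
        exact ⟨T'.2, (relMap_comb_iff A _ x).2 ⟨T', y, hy, rfl⟩⟩
      · rintro ⟨hT, h⟩
        exact (relMap_comb_iff A _ x).1 h

theorem comb_elementarilyEquivalent (A : S → Type (max u v))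
    [∀ T : S, (subLang L T.1.symbols).Structure (A T)]
    {N : RelModel.{max u v, max u v} (Symbols L)}
    (h : Equivalent (RelModel.sum fun T : S => component T.1 (A T)) N) :
    letI := combStructure S N
    Comb A ≅[combLangOf S] N.carrier := by
  let _ := combStructure S N
  exact elementarilyEquivalent_of_equivalent (h.transfer (Equiv.refl _) (Equiv.refl _)
    fun n R => Or.inl ⟨toSymbol S R, relMap_comb_iff A R, fun x => Iff.rfl⟩)

end Components

/-! ### Closure of the cardinalities under addition -/

section Cardinalities

variable {L : FirstOrder.Language.{u, v}} [L.IsRelational]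

theorem mem_restrictPInfty {S : Set (CompleteTheory L)} {B : Type (max u v)}
    [(combLangOf S).Structure B] (b : B) :
    b ∈ restrictPInfty L (fun T : S => T.1.symbols) B ↔ ∀ T : S,
      ¬ Structure.RelMap (L := combLangOf S) (n := 1) (Sum.inr (PSymbol.pred T)) fun _ => b := by
  have hvec : (fun _ : Fin 1 => b) = ![b] := funext fun i => by rw [Subsingleton.elim i 0]; rfl
  rw [hvec]
  constructor
  · intro h T hT
    exact Formula.realize_not.1 (h _ ⟨T, rfl⟩) (Formula.realize_rel₁.2 hT)
  · rintro h _ ⟨T, rfl⟩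
    exact Formula.realize_not.2 fun hT => h T (Formula.realize_rel₁.1 hT)

/-- The predicates naming the components with theories in `S`. -/
abbrev predFamily (S : Set (CompleteTheory L)) (T : S) : Symbols L 1 := predSymbol T.1

/-- A finite model of the theory of the restriction has the same size as the restriction itself, so
cardinalities can be read off there. -/
theorem mem_cHat_iff {𝒯 : Set (CompleteTheory L)} {n : ℕ} : n ∈ cHat 𝒯 ↔
    ∃ S ⊆ 𝒯, ∃ D : S → RelModel.{max u v, max u v} (Symbols L), (∀ T : S, IsComponent T.1 (D T)) ∧
      ∃ N, Equivalent (RelModel.sum D) N ∧ Nonempty (N.atInfinity (predFamily S)).carrier ∧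
        Finite (N.atInfinity (predFamily S)).carrier ∧
          Nat.card (N.atInfinity (predFamily S)).carrier = n := by
  constructor
  · rintro ⟨_, ⟨S, hS, A, _, hA, B, _, hAB, hB, rfl⟩, M, instM, hM, hMT, hfin, rfl⟩
    let e : restrictPInfty L (fun T : S => T.1.symbols) B ≃
        ((ofCombStructure S B).atInfinity (predFamily S)).carrier :=
      Equiv.subtypeEquivRight fun b => (mem_restrictPInfty b).trans
        ⟨fun h T hT => h T hT.2, fun h T hT => h T ⟨T.2, hT⟩⟩
    let _ : (unionLang L fun T : S => T.1.symbols).Structure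
        (restrictPInfty L (fun T : S => T.1.symbols) B) :=
      (LHom.sumInl : unionLang L (fun T : S => T.1.symbols) →ᴸ combLangOf S).reduct _
    let _ : (unionLang L fun T : S => T.1.symbols).Structure M := instM
    have hMB : M ≅[unionLang L fun T : S => T.1.symbols]
        restrictPInfty L (fun T : S => T.1.symbols) B := by
      exact elementarilyEquivalent_iff.2 fun φ =>
        (((theoryPInfty L (fun T : S => T.1.symbols) B).isMaximal.isComplete.realize_sentence_iff φ
          M).trans ((theoryPInfty L (fun T : S => T.1.symbols) B).isMaximal.mem_iff_models
          φ).symm)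
    obtain ⟨hfin', hcard⟩ := finite_and_card_eq hMB
    exact ⟨S, hS, fun T => component T.1 (A T), fun T => ⟨A T, inferInstance, hA T, rfl⟩,
      ofCombStructure S B, (sum_component_equivalent A).trans (ofCombStructure_equivalent hAB),
      hB.map e, Finite.of_equiv _ e, (Nat.card_congr e).symm.trans hcard⟩
  · rintro ⟨S, hS, D, hD, N, hN, hne, hfin, rfl⟩
    choose A instA hA hDA using hD
    obtain rfl : D = fun T => component T.1 (A T) := funext hDA
    let _ := combStructure S N
    let e : restrictPInfty L (fun T : S => T.1.symbols) N.carrier ≃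
        (N.atInfinity (predFamily S)).carrier :=
      Equiv.subtypeEquivRight fun b => mem_restrictPInfty b
    have hne' : Nonempty (restrictPInfty L (fun T : S => T.1.symbols) N.carrier) :=
      hne.map e.symm
    let str : (unionLang L fun T : S => T.1.symbols).Structure
        (restrictPInfty L (fun T : S => T.1.symbols) N.carrier) :=
      (LHom.sumInl : unionLang L (fun T : S => T.1.symbols) →ᴸ combLangOf S).reduct _
    have hmodel : restrictPInfty L (fun T : S => T.1.symbols) N.carrier ⊨
        (unionLang L fun T : S => T.1.symbols).completeTheory
          (restrictPInfty L (fun T : S => T.1.symbols) N.carrier) :=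
      Theory.model_iff_subset_completeTheory.2 subset_rfl
    exact ⟨_, ⟨S, hS, A, instA, hA, N.carrier, inferInstance, comb_elementarilyEquivalent A hN,
      hne', rfl⟩, restrictPInfty L (fun T : S => T.1.symbols) N.carrier, str, hne', hmodel,
      Finite.of_equiv _ e.symm, Nat.card_congr e⟩

theorem add_mem_cHat [IsEmpty (L.Relations 0)] {𝒯 : Set (CompleteTheory L)} {m n : ℕ}
    (hm : m ∈ cHat 𝒯) (hn : n ∈ cHat 𝒯) : m + n ∈ cHat 𝒯 := by
  obtain ⟨S₁, hS₁, D₁, hD₁, N₁, hN₁, hne₁, hfin₁, rfl⟩ := mem_cHat_iff.1 hm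
  obtain ⟨S₂, hS₂, D₂, hD₂, N₂, hN₂, hne₂, hfin₂, rfl⟩ := mem_cHat_iff.1 hn
  have hD : ∀ T : ↥(S₁ ∪ S₂), ∃ D, IsComponent T.1 D := by
    rintro ⟨T, hT | hT⟩
    · exact ⟨_, hD₁ ⟨T, hT⟩⟩
    · exact ⟨_, hD₂ ⟨T, hT⟩⟩
  choose D hD using hD
  have absorb : ∀ {S : Set (CompleteTheory L)} {D : S → RelModel.{max u v, max u v} (Symbols L)},
      (∀ T : S, IsComponent T.1 (D T)) → ∀ {N}, Equivalent (RelModel.sum D) N →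
      Equivalent (RelModel.sum D)
        (RelModel.sum fun o : Option S => o.elim (N.atInfinity (predFamily S)) D) :=
    fun hD N hN => sum_equivalent_sum_atInfinity (fun T T' y =>
      ((hD T).rel_predSymbol T'.1 y).trans Subtype.ext_iff.symm) hN
  -- This is needed for `T` outside `S` too: `C₁` must avoid the predicates coming from `S₂`, and
  -- conversely.
  have no_pred : ∀ {S : Set (CompleteTheory L)}
      {D : S → RelModel.{max u v, max u v} (Symbols L)}, (∀ T : S, IsComponent T.1 (D T)) →
      ∀ {N}, Equivalent (RelModel.sum D) N → ∀ T y,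
        ¬ (N.atInfinity (predFamily S)).rel (predSymbol T) y := by
    intro S D hD N hN T y hy
    have hy' : N.rel (predSymbol T) fun _ => (y 0).1 := by
      have hy₀ : y = fun _ => y 0 := funext fun k => by rw [Subsingleton.elim k 0]
      rw [hy₀] at hy
      exact hy
    exact (y 0).2 ⟨T, mem_of_rel_predSymbol hD hN hy'⟩ hy'
  let C₁ := N₁.atInfinity (predFamily S₁)
  let C₂ := N₂.atInfinity (predFamily S₂)
  let E : Option ↥(S₁ ∪ S₂) → RelModel.{max u v, max u v} (Symbols L) := fun o => o.elim C₁ D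
  let N := RelModel.sum fun o : Option (Option ↥(S₁ ∪ S₂)) => o.elim C₂ E
  have hN : Equivalent (RelModel.sum D) N := by
    -- The components over `S₁` absorb `C₁`; those over `S₂`, found under `some` in the enlarged
    -- family, then absorb `C₂`.
    refine (sum_equivalent_sum_option (i := Set.inclusion Set.subset_union_left)
      (Set.inclusion_injective _) (fun T => (hD _).equivalent (hD₁ T)) (absorb hD₁ hN₁)).trans
      (sum_equivalent_sum_option (i := fun T => some (Set.inclusion Set.subset_union_right T))
      ((Option.some_injective _).comp (Set.inclusion_injective _))
      (fun T => (hD _).equivalent (hD₂ T)) (absorb hD₂ hN₂))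
  let f : C₁.carrier ⊕ C₂.carrier → (N.atInfinity (predFamily (S₁ ∪ S₂))).carrier := fun c =>
    match c with
    | Sum.inl c => ⟨⟨some none, c⟩, by
        rintro T ⟨o, y, hy, hR⟩
        obtain rfl : some none = o := congrArg Sigma.fst (hy 0)
        exact no_pred hD₁ hN₁ _ _ hR⟩
    | Sum.inr c => ⟨⟨none, c⟩, by
        rintro T ⟨o, y, hy, hR⟩
        obtain rfl : none = o := congrArg Sigma.fst (hy 0)
        exact no_pred hD₂ hN₂ _ _ hR⟩
  have hf : f.Bijective := by
    constructor
    · rintro (c | c) (d | d) hcd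
      · exact congrArg Sum.inl (eq_of_heq (Sigma.mk.inj (congrArg Subtype.val hcd)).2)
      · cases (Sigma.mk.inj (congrArg Subtype.val hcd)).1
      · cases (Sigma.mk.inj (congrArg Subtype.val hcd)).1
      · exact congrArg Sum.inr (eq_of_heq (Sigma.mk.inj (congrArg Subtype.val hcd)).2)
    · rintro ⟨⟨_ | _ | T, c⟩, hc⟩
      · exact ⟨Sum.inr c, rfl⟩
      · exact ⟨Sum.inl c, rfl⟩
      · exact absurd ⟨some (some T), fun _ => c, fun _ => rfl,
          ((hD T).rel_predSymbol T.1 _).2 rfl⟩ (hc T)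
  let e := Equiv.ofBijective f hf
  exact mem_cHat_iff.2 ⟨S₁ ∪ S₂, Set.union_subset hS₁ hS₂, D, hD, N, hN,
    hne₁.map fun c => f (Sum.inl c), Finite.of_equiv _ e,
    (Nat.card_congr e).symm.trans Nat.card_sum⟩

end Cardinalities

/-- A positive multiple is a repeated sum, so sums of multiples stay in `K`; conversely each member
is a one-term sum. -/
theorem finiteSums_eq_self {K : Set ℕ} (hK : ∀ m ∈ K, ∀ n ∈ K, m + n ∈ K) : finiteSums K = K := by
  have mul_mem : ∀ k ∈ K, ∀ j, k * (j + 1) ∈ K := by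
    intro k hk j
    induction j with
    | zero => simpa using hk
    | succ j ih => exact hK _ ih _ hk
  ext n
  constructor
  · rintro ⟨s, hs, h, rfl⟩
    have hsK : ∀ m ∈ s, m ∈ K := by
      intro m hm
      obtain ⟨k, hk, j, hj, rfl⟩ := h m hm
      obtain ⟨j, rfl⟩ := Nat.exists_eq_add_of_lt hj
      simpa using mul_mem k hk j
    exact Multiset.sum_induction_nonempty (· ∈ K) (fun a b ha hb => hK a ha b hb) hs hsK
  · intro hn
    exact ⟨{n}, Multiset.singleton_ne_zero n, fun m hm => ⟨n, hn, 1, one_pos, by simpa using hm⟩,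
      Multiset.sum_singleton n⟩

end PCombination

theorem theorem6p6 {L : FirstOrder.Language.{u, v}} [L.IsRelational] [IsEmpty (L.Relations 0)]
    (𝒯 : Set (PCombination.CompleteTheory L)) (h𝒯 : 𝒯.Infinite) :
    ∃ K : Set ℕ, PCombination.cHat 𝒯 = PCombination.finiteSums K :=
  ⟨PCombination.cHat 𝒯, (PCombination.finiteSums_eq_self fun _ hm _ hn =>
    PCombination.add_mem_cHat hm hn).symm⟩
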